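/- Work in $\mathbb{Z}[q]$. For integers $n\ge 0$ put $[n]_q = 1+q+\cdots+q^{n-1}$ (so $[0]_q=0$) and $[n]_q! = \prod_{j=1}^{n}[j]_q$ (so $[0]_q!=1$), and for $n,k\geq 0$ let $$\binom{n}{k}_q=\frac{[n]_q!}{[k]_q!\,[n-k]_q!}\in\mathbb{Z}[q]\quad (k\le n),\qquad \binom{n}{k}_q=0\quad (k>n)$$ be the $q$-binomial coefficient. Let $\mathsf F(q)=(f_{n,k}(q))_{n,k\ge 0}$ be the infinite matrix with $$f_{n,k}(q)=\begin{cases}\delta_{nk} & \text{if } k=0,\\ \binom{n-1}{k-1}_q\,([n]_q)^{n-k} & \text{if } n\ge k\ge 1,\\ 0 & \text{otherwise,}\end{cases}$$ where $\delta_{nk}$ is the Kronecker delta, and let $\mathsf T(q)=(t_{n,k}(q))_{n,k\ge 0}$ be the infinite matrix with $t_{n,k}(q)=\binom{n}{k}_q([n]_q)^{n-k}$ if $n\ge k\ge 0$ and $t_{n,k}(q)=0$ if $k>n$ (here $([0]_q)^0=1$). **Theorem.** The matrices $\mathsf F(q)$ and $\mathsf T(q)$ are coefficientwise totally positive: for every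 $r\ge 0$ and all row indices $0\le i_1<\cdots<i_r$ and column indices $0\le j_1<\cdots<j_r$, the minors $\det\big(f_{i_a,j_b}(q)\big)_{1\le a,b\le r}$ and $\det\big(t_{i_a,j_b}(q)\big)_{1\le a,b\le r}$ are polynomials in $q$ all of whose coefficients are nonnegative. -/

import Mathlib

open Polynomial

noncomputable section

namespace QForests

/-- The `q`-integer `[n]_q = 1 + q + ⋯ + q^(n-1)` in `ℤ[q]`, the indeterminate `q` being `X`;
in particular `[0]_q = 0`. -/
def qInt (n : ℕ) : ℤ[X] := ∑ i ∈ Finset.range n, X ^ i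

/-- The `q`-factorial `[n]_q! = [1]_q [2]_q ⋯ [n]_q`, with `[0]_q! = 1`. -/
def qFactorial (n : ℕ) : ℤ[X] := ∏ j ∈ Finset.Icc 1 n, qInt j

/-- The `q`-binomial coefficient `[n]_q! / ([k]_q! [n-k]_q!)` for `k ≤ n`, and `0` for `k > n`.
The denominator is monic (`monic_qFactorial`) and the division is exact (`qBinom_mul`). -/
def qBinom (n k : ℕ) : ℤ[X] :=
  if k ≤ n then qFactorial n /ₘ (qFactorial k * qFactorial (n - k)) else 0

/-- The `q`-forests matrix, with rows and columns indexed by `0, 1, 2, …`. -/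
def qForests : Matrix ℕ ℕ ℤ[X] := Matrix.of fun n k =>
  if k = 0 then (if n = k then 1 else 0)
  else if k ≤ n then qBinom (n - 1) (k - 1) * qInt n ^ (n - k)
  else 0

/-- The `q`-trees matrix, with rows and columns indexed by `0, 1, 2, …`; the entries with `k > n`
vanish because `qBinom n k` does. -/
def qTrees : Matrix ℕ ℕ ℤ[X] := Matrix.of fun n k => qBinom n k * qInt n ^ (n - k)

/-- A polynomial is nonnegative in the coefficientwise order if all its coefficients are. -/
def CoeffNonneg (p : ℤ[X]) : Prop := ∀ i : ℕ, 0 ≤ p.coeff i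

/-- A matrix over `ℤ[q]` with rows and columns indexed by `ℕ` is coefficientwise totally positive
if all its minors (with rows `i 0 < i 1 < ⋯` and columns `j 0 < j 1 < ⋯`, of every finite size)
are polynomials with nonnegative coefficients. -/
def CoeffTotallyPositive (M : Matrix ℕ ℕ ℤ[X]) : Prop :=
  ∀ (r : ℕ) (i j : Fin r → ℕ), StrictMono i → StrictMono j →
    CoeffNonneg (M.submatrix i j).det

/-! The denominators in `qBinom` are monic and the quotients are exact. -/

theorem qFactorial_succ (n : ℕ) : qFactorial (n + 1) = qFactorial n * qInt (n + 1) := by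
  simp [qFactorial, Finset.prod_Icc_succ_top]

theorem monic_qFactorial (n : ℕ) : (qFactorial n).Monic := by
  refine monic_prod_of_monic _ _ fun j hj => ?_
  have h := (Finset.mem_Icc.1 hj).1
  exact monic_geom_sum_X (by omega)

theorem qInt_add (a b : ℕ) : qInt (a + b) = qInt a + X ^ a * qInt b := by
  simp [qInt, Finset.sum_range_add, pow_add, Finset.mul_sum]

theorem qFactorial_dvd (a b : ℕ) : qFactorial a * qFactorial b ∣ qFactorial (a + b) := by
  induction h : a + b generalizing a b with
  | zero =>
    obtain ⟨rfl, rfl⟩ : a = 0 ∧ b = 0 := by omega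
    simp [qFactorial]
  | succ n ih =>
    rcases a with _ | a
    · obtain rfl : b = n + 1 := by omega
      simp [qFactorial]
    rcases b with _ | b
    · obtain rfl : a = n := by omega
      simp [qFactorial]
    obtain ⟨c, hc⟩ := ih a (b + 1) (by omega)
    obtain ⟨d, hd⟩ := ih (a + 1) b (by omega)
    refine ⟨c + X ^ (a + 1) * d, ?_⟩
    have e : qInt (n + 1) = qInt (a + 1) + X ^ (a + 1) * qInt (b + 1) := by
      rw [← qInt_add, h]
    rw [qFactorial_succ n, e, mul_add]
    nth_rewrite 1 [hc]
    rw [hd]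
    simp only [qFactorial_succ]
    ring

theorem qBinom_mul {n k : ℕ} (h : k ≤ n) :
    qFactorial k * qFactorial (n - k) * qBinom n k = qFactorial n := by
  have hm := (monic_qFactorial k).mul (monic_qFactorial (n - k))
  have hd := qFactorial_dvd k (n - k)
  rw [Nat.add_sub_cancel' h] at hd
  have := modByMonic_add_div (qFactorial n) (qFactorial k * qFactorial (n - k))
  rw [(modByMonic_eq_zero_iff_dvd hm).2 hd, zero_add] at this
  rw [qBinom, if_pos h, this]

end QForests

end

open Polynomial

noncomputable section

namespace QForests

/-! Both matrices belong to families indexed by a shift: `qForests` is `abelMatrix 0`, `qTrees` is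
`shiftedTrees 0`. Two factorisations link the families. By `shiftedTrees_eq`, `shiftedTrees s` is
`abelMatrix s` times a unit lower triangular matrix, a product of nonnegative elementary column
operations. By definition, `abelMatrix m` without its first row is `shiftedTrees (m + 1)` times a
nonnegative upper bidiagonal matrix, and its first row is a unit vector. Adjacent-column operations
(`column_op`, `sweep`) and adjoining that row (`cons_unit`) preserve total positivity. Hence
positivity of the first `R` rows at shift `m + 1` gives that of the first `R + 1` rows at shift `m`:
induct on `R` for all shifts at once. -/

theorem CoeffNonneg.zero : CoeffNonneg 0 := fun i => by simp

theorem CoeffNonneg.one : CoeffNonneg 1 := fun i => by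
  rw [coeff_one]
  split_ifs <;> norm_num

theorem CoeffNonneg.add {p q : ℤ[X]} (hp : CoeffNonneg p) (hq : CoeffNonneg q) :
    CoeffNonneg (p + q) := fun i => by
  rw [coeff_add]
  exact add_nonneg (hp i) (hq i)

theorem CoeffNonneg.mul {p q : ℤ[X]} (hp : CoeffNonneg p) (hq : CoeffNonneg q) :
    CoeffNonneg (p * q) := fun i => by
  rw [coeff_mul]
  exact Finset.sum_nonneg fun x _ => mul_nonneg (hp _) (hq _)

theorem CoeffNonneg.X_pow (n : ℕ) : CoeffNonneg (X ^ n) := fun i => by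
  rw [coeff_X_pow]
  split_ifs <;> norm_num

theorem CoeffNonneg.qInt (n : ℕ) : CoeffNonneg (qInt n) := fun i => by
  rw [QForests.qInt, finsetSum_coeff]
  exact Finset.sum_nonneg fun k _ => CoeffNonneg.X_pow k i

/-! ### `q`-binomial coefficients -/

theorem qInt_zero : qInt 0 = 0 := by simp [qInt]

theorem qFactorial_zero : qFactorial 0 = 1 := by simp [qFactorial]

theorem qBinom_of_lt {n k : ℕ} (h : n < k) : qBinom n k = 0 := by
  rw [qBinom, if_neg (by omega)]

theorem qBinom_self (n : ℕ) : qBinom n n = 1 := by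
  have h := qBinom_mul (le_refl n)
  rw [Nat.sub_self, qFactorial_zero, mul_one] at h
  exact mul_left_cancel₀ (monic_qFactorial n).ne_zero (by rw [h, mul_one])

theorem qBinom_zero_right (n : ℕ) : qBinom n 0 = 1 := by
  have h := qBinom_mul (Nat.zero_le n)
  rw [Nat.sub_zero, qFactorial_zero, one_mul] at h
  exact mul_left_cancel₀ (monic_qFactorial n).ne_zero (by rw [h, mul_one])

theorem qInt_mul_qBinom_succ (n k : ℕ) :
    qInt (k + 1) * qBinom (n + 1) (k + 1) = qInt (n + 1) * qBinom n k := by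
  rcases lt_or_ge n k with h | h
  · rw [qBinom_of_lt h, qBinom_of_lt (by omega), mul_zero, mul_zero]
  · have h₁ := qBinom_mul h
    have h₂ := qBinom_mul (Nat.succ_le_succ h)
    simp only [Nat.succ_eq_add_one, Nat.add_sub_add_right, qFactorial_succ] at h₂
    refine mul_left_cancel₀
      ((monic_qFactorial k).mul (monic_qFactorial (n - k))).ne_zero ?_
    linear_combination h₂ - qInt (n + 1) * h₁

theorem qInt_sub_mul_qBinom (n k : ℕ) (h : k ≤ n) :
    qInt (n + 1 - k) * qBinom (n + 1) k = qInt (n + 1) * qBinom n k := by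
  have h₁ := qBinom_mul h
  have h₂ := qBinom_mul (Nat.le_succ_of_le h)
  rw [Nat.succ_eq_add_one, Nat.succ_sub h, Nat.succ_eq_add_one, qFactorial_succ,
    qFactorial_succ] at h₂
  rw [Nat.succ_sub h, Nat.succ_eq_add_one]
  refine mul_left_cancel₀
    ((monic_qFactorial k).mul (monic_qFactorial (n - k))).ne_zero ?_
  linear_combination h₂ - qInt (n + 1) * h₁

theorem qInt_succ_ne_zero (n : ℕ) : qInt (n + 1) ≠ 0 :=
  (monic_geom_sum_X (Nat.succ_ne_zero n)).ne_zero

/-- The `q`-Pascal recurrence. -/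
theorem qBinom_succ_succ (n k : ℕ) :
    qBinom (n + 1) (k + 1) = qBinom n k + X ^ (k + 1) * qBinom n (k + 1) := by
  rcases lt_trichotomy n k with h | rfl | h
  · rw [qBinom_of_lt h, qBinom_of_lt (by omega), qBinom_of_lt (by omega), mul_zero, add_zero]
  · rw [qBinom_self, qBinom_self, qBinom_of_lt (by omega), mul_zero, add_zero]
  · have h₁ := qInt_mul_qBinom_succ n k
    have h₂ := qInt_sub_mul_qBinom n (k + 1) h
    have e : qInt (n + 1) = qInt (k + 1) + X ^ (k + 1) * qInt (n + 1 - (k + 1)) := by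
      rw [← qInt_add]
      congr 1
      omega
    refine mul_left_cancel₀ (qInt_succ_ne_zero n) ?_
    linear_combination h₁ + X ^ (k + 1) * h₂ + qBinom (n + 1) (k + 1) * e

/-! ### Total positivity of the leading rows -/

/-- All minors of `M` that use only the rows `0, …, R - 1` have nonnegative coefficients. -/
def RowsTotallyPositive (R : ℕ) (M : Matrix ℕ ℕ ℤ[X]) : Prop :=
  ∀ (r : ℕ) (i j : Fin r → ℕ), StrictMono i → StrictMono j → (∀ a, i a < R) →
    CoeffNonneg (M.submatrix i j).det

theorem RowsTotallyPositive.congr {R : ℕ} {M N : Matrix ℕ ℕ ℤ[X]}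
    (hM : RowsTotallyPositive R M) (h : ∀ n < R, ∀ k, N n k = M n k) :
    RowsTotallyPositive R N := by
  intro r i j hi hj hR
  have e : N.submatrix i j = M.submatrix i j := by
    ext1 a b
    exact h _ (hR a) _
  rw [e]
  exact hM r i j hi hj hR

theorem coeffTotallyPositive_of_rows {M : Matrix ℕ ℕ ℤ[X]}
    (h : ∀ R, RowsTotallyPositive R M) : CoeffTotallyPositive M := by
  intro r i j hi hj
  refine h (Finset.univ.sup i + 1) r i j hi hj fun a => ?_
  exact Nat.lt_succ_of_le (Finset.le_sup (f := i) (Finset.mem_univ a))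

/-- No integer lies strictly between `j b` and `s`, so the swap cannot jump over another chosen
column and no sign appears. -/
theorem strictMono_update_adjacent {r : ℕ} {j : Fin r → ℕ} (hj : StrictMono j) {b : Fin r}
    {s : ℕ} (hs : s = j b + 1 ∨ s + 1 = j b) (hsj : ∀ x, j x ≠ s) :
    StrictMono (Function.update j b s) := by
  intro x y hxy
  have h := hj hxy
  have hx := hsj x
  have hy := hsj y
  simp only [Function.update_apply]
  split_ifs with h₁ h₂ h₂
  · exact absurd hxy (by rw [h₁, h₂]; exact lt_irrefl b)
  · subst h₁; omega
  · subst h₂; omega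
  · exact h

/-- Replacing a column by a nonnegative combination of itself and an adjacent column preserves
total positivity. -/
theorem RowsTotallyPositive.column_op {R : ℕ} {M N : Matrix ℕ ℕ ℤ[X]}
    (hM : RowsTotallyPositive R M) {t s : ℕ} (hs : s = t + 1 ∨ s + 1 = t) {u c : ℤ[X]}
    (hu : CoeffNonneg u) (hc : CoeffNonneg c)
    (hne : ∀ n < R, ∀ k, k ≠ t → N n k = M n k)
    (ht : ∀ n < R, N n t = u * M n t + c * M n s) :
    RowsTotallyPositive R N := by
  intro r i j hi hj hR
  by_cases hb : ∃ b, j b = t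
  · obtain ⟨b, rfl⟩ := hb
    have e : N.submatrix i j = (M.submatrix i j).updateCol b
        (u • (fun a => M (i a) (j b)) + c • fun a => M (i a) s) := by
      ext1 a x
      rcases eq_or_ne x b with rfl | hx
      · simp [ht _ (hR a)]
      · simp [hx, hne _ (hR a) _ (hj.injective.ne hx)]
    have e₁ : (M.submatrix i j).updateCol b (fun a => M (i a) (j b)) = M.submatrix i j :=
      Matrix.updateCol_eq_self _ b
    rw [e, Matrix.det_updateCol_add, Matrix.det_updateCol_smul, Matrix.det_updateCol_smul, e₁]
    refine (hu.mul (hM r i j hi hj hR)).add (hc.mul ?_)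
    -- If column `s` is already chosen, the second determinant has a repeated column; otherwise it
    -- is again a minor of `M`.
    by_cases hsj : ∃ x, j x = s
    · obtain ⟨x, rfl⟩ := hsj
      have hxb : x ≠ b := by rintro rfl; omega
      rw [Matrix.det_zero_of_column_eq hxb fun a => by simp [hxb]]
      exact CoeffNonneg.zero
    · push Not at hsj
      have e₂ : (M.submatrix i j).updateCol b (fun a => M (i a) s) =
          M.submatrix i (Function.update j b s) := by
        ext1 a x
        rcases eq_or_ne x b with rfl | hx
        · simp
        · simp [hx]
      rw [e₂]
      exact hM r i _ hi (strictMono_update_adjacent hj hs hsj) hR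
  · push Not at hb
    have e : N.submatrix i j = M.submatrix i j := by
      ext1 a x
      exact hne _ (hR a) _ (hb x)
    rw [e]
    exact hM r i j hi hj hR

/-- Column operations performed from right to left, where the columns from `T` on are
unchanged. -/
theorem RowsTotallyPositive.sweep {R T : ℕ} {M N : Matrix ℕ ℕ ℤ[X]}
    (hM : RowsTotallyPositive R M) (hT : ∀ n < R, ∀ k, T ≤ k → N n k = M n k)
    (step : ∀ (t : ℕ) (H H' : Matrix ℕ ℕ ℤ[X]), RowsTotallyPositive R H →
      (∀ n k, H n k = if t < k then N n k else M n k) →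
      (∀ n k, H' n k = if t ≤ k then N n k else M n k) → RowsTotallyPositive R H') :
    RowsTotallyPositive R N := by
  have key : ∀ d ≤ T, RowsTotallyPositive R
      (Matrix.of fun n k => if T - d ≤ k then N n k else M n k) := by
    intro d
    induction d with
    | zero =>
      intro _
      refine hM.congr fun n hn k => ?_
      simp only [Matrix.of_apply, Nat.sub_zero]
      split_ifs with h
      · exact hT n hn k h
      · rfl
    | succ d ih =>
      intro hd
      refine step (T - (d + 1)) _ _ (ih (by omega)) (fun n k => ?_) fun n k => rfl
      have : T - d ≤ k ↔ T - (d + 1) < k := by omega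
      simp only [Matrix.of_apply, this]
  exact (key T le_rfl).congr fun n _ k => by simp

/-- Adjoining the first unit vector as a new first row preserves total positivity. -/
theorem RowsTotallyPositive.cons_unit {R : ℕ} {M N : Matrix ℕ ℕ ℤ[X]}
    (hM : RowsTotallyPositive R M) (h₀ : ∀ k, N 0 k = if k = 0 then 1 else 0)
    (h : ∀ n k, N (n + 1) k = M n k) : RowsTotallyPositive (R + 1) N := by
  have pos : ∀ (r : ℕ) (i j : Fin r → ℕ), StrictMono i → StrictMono j → (∀ a, i a < R + 1) →
      (∀ a, 0 < i a) → CoeffNonneg (N.submatrix i j).det := by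
    intro r i j hi hj hR hp
    have e : N.submatrix i j = M.submatrix (fun a => i a - 1) j := by
      ext1 a b
      have := h (i a - 1) (j b)
      rwa [Nat.sub_add_cancel (hp a)] at this
    rw [e]
    refine hM r _ j (fun a b hab => ?_) hj fun a => ?_
    · have h₁ := hi hab
      have h₂ := hp a
      show i a - 1 < i b - 1
      omega
    · have h₁ := hR a
      have h₂ := hp a
      omega
  intro r i j hi hj hR
  rcases r with _ | r
  · rw [Matrix.det_fin_zero]
    exact CoeffNonneg.one
  rcases Nat.eq_zero_or_pos (i 0) with hi0 | hi0
  · have hjs : ∀ b : Fin r, j b.succ ≠ 0 := fun b => by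
      have := hj (Fin.succ_pos b)
      omega
    -- Only the first chosen column can be column `0`, so one term of the expansion survives.
    rw [Matrix.det_succ_row_zero, Fin.sum_univ_succ, Finset.sum_eq_zero fun b _ => by
      simp [hi0, h₀, hjs]]
    simp only [Fin.val_zero, pow_zero, one_mul, add_zero, Matrix.submatrix_apply, hi0, h₀,
      Matrix.submatrix_submatrix]
    refine CoeffNonneg.mul ?_ (pos r _ _ (hi.comp (Fin.strictMono_succ))
      (hj.comp (Fin.strictMono_succAbove 0)) (fun a => hR _) fun a => ?_)
    · split_ifs
      · exact CoeffNonneg.one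
      · exact CoeffNonneg.zero
    · have := hi (Fin.succ_pos a)
      show 0 < i a.succ
      omega
  · exact pos _ i j hi hj hR fun a => hi0.trans_le (hi.monotone (Fin.zero_le a))

/-! ### The `q`-Abel matrices -/

/-- The `q`-trees matrix with shifted base: the entries are `qBinom n k * [n + s]_q ^ (n - k)`. -/
def shiftedTrees (s : ℕ) : Matrix ℕ ℕ ℤ[X] :=
  Matrix.of fun n k => qBinom n k * qInt (n + s) ^ (n - k)

/-- The matrix with row `0` equal to the first unit vector and row `n + 1` obtained from row `n` of
`shiftedTrees (m + 1)` by an upper bidiagonal transformation. In closed form the entries for `k < n`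
are `qBinom n k * [k + m]_q * [n + m]_q ^ (n - k - 1)`, a `q`-analogue of the coefficients of the
shifted Abel polynomials `(x + m) * (x + m + n) ^ (n - 1)`. -/
def abelMatrix (m : ℕ) : Matrix ℕ ℕ ℤ[X] := Matrix.of fun n k =>
  match n, k with
  | 0, 0 => 1
  | 0, _ + 1 => 0
  | n + 1, 0 => qInt m * shiftedTrees (m + 1) n 0
  | n + 1, k + 1 =>
    X ^ (k + 1) * qInt m * shiftedTrees (m + 1) n (k + 1) + shiftedTrees (m + 1) n k

theorem shiftedTrees_of_lt (s : ℕ) {n k : ℕ} (h : n < k) : shiftedTrees s n k = 0 := by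
  simp [shiftedTrees, qBinom_of_lt h]

theorem abelMatrix_of_lt (m : ℕ) {n k : ℕ} (h : n < k) : abelMatrix m n k = 0 := by
  rcases k with _ | k
  · omega
  rcases n with _ | n
  · simp [abelMatrix]
  · simp [abelMatrix, shiftedTrees_of_lt (m + 1) (show n < k by omega),
      shiftedTrees_of_lt (m + 1) (show n < k + 1 by omega)]

/-- In row `n + 1`, split the binomial by `q`-Pascal and one factor as `[n+1+s] = [s] + q^s [n+1]`;
absorption turns the `q^s [n+1]` part into the entry one column to the right. -/
theorem shiftedTrees_eq (s n k : ℕ) :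
    shiftedTrees s n k =
      abelMatrix s n k + X ^ (k + s) * qInt (k + 1) * shiftedTrees s n (k + 1) := by
  rcases n with _ | n
  · rw [shiftedTrees_of_lt s (Nat.succ_pos k), mul_zero, add_zero]
    rcases k with _ | k
    · simp [shiftedTrees, abelMatrix, qBinom_self]
    · rw [shiftedTrees_of_lt s (Nat.succ_pos k), abelMatrix_of_lt s (Nat.succ_pos k)]
  have hs : qInt (n + 1 + s) = qInt s + X ^ s * qInt (n + 1) := by rw [← qInt_add, add_comm]
  have hb := qInt_mul_qBinom_succ n k
  have hms : n + (s + 1) = n + 1 + s := by omega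
  rcases k with _ | k
  · have h0 : qBinom (n + 1) 0 = 1 := qBinom_zero_right _
    have h0' : qBinom n 0 = 1 := qBinom_zero_right _
    simp only [shiftedTrees, abelMatrix, Matrix.of_apply, hms, h0, h0', Nat.sub_zero,
      Nat.add_sub_cancel, zero_add, pow_succ] at hb ⊢
    linear_combination qInt (n + 1 + s) ^ n * hs - X ^ s * qInt (n + 1 + s) ^ n * hb
  · simp only [shiftedTrees, abelMatrix, Matrix.of_apply, hms, Nat.add_sub_add_right]
    rcases lt_or_ge n (k + 1) with h | h
    · simp [qBinom_of_lt h, qBinom_of_lt (Nat.succ_lt_succ h), qBinom_succ_succ n k]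
    · obtain ⟨d, rfl⟩ := Nat.exists_eq_add_of_le h
      have e₁ : k + 1 + d - k = d + 1 := by omega
      have e₂ : k + 1 + d - (k + 1) = d := by omega
      rw [e₁, e₂, qBinom_succ_succ (k + 1 + d) k]
      linear_combination
        X ^ (k + 1) * qBinom (k + 1 + d) (k + 1) * qInt (k + 1 + d + 1 + s) ^ d * hs
        - X ^ (k + 1 + s) * qInt (k + 1 + d + 1 + s) ^ d * hb

theorem shiftedTrees_rowsTotallyPositive {R s : ℕ} (h : RowsTotallyPositive R (abelMatrix s)) :
    RowsTotallyPositive R (shiftedTrees s) := by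
  refine h.sweep (T := R) (fun n hn k hk => ?_) fun t H H' hH h₁ h₂ => ?_
  · rw [shiftedTrees_of_lt s (by omega), abelMatrix_of_lt s (by omega)]
  · refine hH.column_op (t := t) (Or.inl rfl) CoeffNonneg.one
      ((CoeffNonneg.X_pow (t + s)).mul (CoeffNonneg.qInt (t + 1))) (fun n _ k hk => ?_)
      fun n _ => ?_
    · have : t ≤ k ↔ t < k := by omega
      simp only [h₁, h₂, this]
    · rw [h₁, h₁, h₂, if_pos le_rfl, if_neg (lt_irrefl t), if_pos (Nat.lt_succ_self t), one_mul]
      exact shiftedTrees_eq s n t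

theorem abelMatrix_rowsTotallyPositive (R m : ℕ) : RowsTotallyPositive R (abelMatrix m) := by
  induction R generalizing m with
  | zero =>
    intro r i j _ _ hR
    rcases r with _ | r
    · rw [Matrix.det_fin_zero]
      exact CoeffNonneg.one
    · exact absurd (hR 0) (Nat.not_lt_zero _)
  | succ R ih =>
    refine RowsTotallyPositive.cons_unit (M := Matrix.of fun n k => abelMatrix m (n + 1) k) ?_
      (fun k => by cases k <;> simp [abelMatrix]) fun n k => rfl
    refine (shiftedTrees_rowsTotallyPositive (ih (m + 1))).sweep (T := R + 1)
      (fun n hn k hk => ?_) fun t H H' hH h₁ h₂ => ?_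
    · rw [shiftedTrees_of_lt _ (by omega)]
      exact abelMatrix_of_lt m (by omega)
    · have hne : ∀ n < R, ∀ k, k ≠ t → H' n k = H n k := fun n _ k hk => by
        have : t ≤ k ↔ t < k := by omega
        simp only [h₁, h₂, this]
      rcases t with _ | t
      -- Column `0` has no left neighbour: it is only scaled, and its right neighbour enters with
      -- coefficient `0`.
      · refine hH.column_op (Or.inl rfl) (CoeffNonneg.qInt m) CoeffNonneg.zero hne fun n _ => ?_
        rw [h₁, h₂, if_pos le_rfl, if_neg (lt_irrefl _), zero_mul, add_zero]
        rfl
      · refine hH.column_op (s := t) (Or.inr rfl)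
          ((CoeffNonneg.X_pow (t + 1)).mul (CoeffNonneg.qInt m)) CoeffNonneg.one hne fun n _ => ?_
        rw [h₁, h₁, h₂, if_pos le_rfl, if_neg (lt_irrefl _), if_neg (by omega), one_mul]
        rfl

/-- At `m = 0` the factor `[0]_q` kills every bidiagonal term except the shift of columns by one. -/
theorem qForests_eq_abelMatrix : qForests = abelMatrix 0 := by
  ext1 n k
  rcases n with _ | n <;> rcases k with _ | k
  · simp [qForests, abelMatrix]
  · simp [qForests, abelMatrix]
  · simp [qForests, abelMatrix, qInt_zero]
  · rcases le_or_gt k n with h | h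
    · simp [qForests, abelMatrix, shiftedTrees, qInt_zero, h]
    · rw [abelMatrix_of_lt 0 (Nat.succ_lt_succ h)]
      simp [qForests, h]

theorem qTrees_eq_shiftedTrees : qTrees = shiftedTrees 0 := rfl

end QForests

end

/-- The `q`-forests matrix and the `q`-trees matrix are coefficientwise totally positive. -/
theorem theorem1p2 :
    QForests.CoeffTotallyPositive QForests.qForests ∧
      QForests.CoeffTotallyPositive QForests.qTrees := by
  rw [QForests.qForests_eq_abelMatrix, QForests.qTrees_eq_shiftedTrees]
  exact ⟨QForests.coeffTotallyPositive_of_rows fun R =>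
      QForests.abelMatrix_rowsTotallyPositive R 0,
    QForests.coeffTotallyPositive_of_rows fun R =>
      QForests.shiftedTrees_rowsTotallyPositive (QForests.abelMatrix_rowsTotallyPositive R 0)⟩
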